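/- Let $R$ be a (finite, reduced, crystallographic) root system spanning a real Euclidean space $E$ with scalar product $\langle\cdot,\cdot\rangle$, let $W$ be its Weyl group, i.e. the finite group generated by the orthogonal reflections $x\mapsto x-\frac{2\langle x,\alpha\rangle}{\langle\alpha,\alpha\rangle}\alpha$ in the roots $\alpha\in R$, and fix a base of simple roots $\alpha_1,\dots,\alpha_n$; write $\alpha>0$ if the root $\alpha$ is positive with respect to this base, let $r$ be the number of positive roots, and let $\rho=\frac12\sum_{\alpha>0}\alpha$. For a strictly dominant $\lambda\in E$ (that is, $\langle\lambda,\alpha_i\rangle>0$ for all $i$) the antisymmetric orbit function is $$\varphi_\lambda(x)=\sum_{w\in W}(\det w)\,e^{2\pi i\langle w\lambda,x\rangle},\qquad x\in E.$$ Then $\rho$ is strictly dominant (so that $\varphi_\rho$ is defined), and for every $x\in E$ $$\varphi_\rho(x)=\prod_{\alpha>0}\left(e^{\pi i\langle\alpha,x\rangle}-e^{-\pi i\langle\alpha,x\rangle}\right)=e^{2\pi i\langle\rho,x\rangle}\prod_{\alpha>0}\left(1-e^{-2\pi i\langle\alpha,x\rangle}\right)=(2i)^r\prod_{\alpha>0}\sin\pi\langle\alpha,x\rangle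 .$$ -/

import Mathlib

open scoped RealInnerProductSpace

namespace OrbitFunction

variable {ι E N : Type*} [Fintype ι] [NormedAddCommGroup E] [InnerProductSpace ℝ E]
  [AddCommGroup N] [Module ℝ N]

/-- The Weyl group of a finite root system is finite: it acts faithfully on the set of roots. -/
instance finite_weylGroup (P : RootPairing ι ℝ E N) [P.IsRootSystem] : Finite P.weylGroup := by
  refine Finite.of_injective (fun g : P.weylGroup ↦ P.weylGroupToPerm g) fun g h hgh ↦ ?_
  apply Subtype.ext
  apply RootPairing.Equiv.weightHom_injective P
  apply LinearEquiv.toLinearMap_injective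
  apply LinearMap.ext_on_range (v := P.root) (RootPairing.IsRootSystem.span_root_eq_top (P := P))
  intro i
  have h1 := P.weylGroup_apply_root g i
  have h2 := P.weylGroup_apply_root h i
  simp only at hgh
  rw [hgh, ← h2] at h1
  exact h1

/-- The root system `P` is realised in the Euclidean space `E`: the reflection in each root `α` is
the orthogonal one, `x ↦ x - (2⟨x, α⟩ / ⟨α, α⟩) α`. -/
def IsEuclidean (P : RootPairing ι ℝ E N) : Prop :=
  ∀ (i : ι) (x : E),
    P.reflection i x = x - (2 * ⟪x, P.root i⟫ / ⟪P.root i, P.root i⟫) • P.root i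

/-- The determinant (`±1`) of an element of the Weyl group, as a linear transformation of `E`. -/
noncomputable def weylDet (P : RootPairing ι ℝ E N) (w : P.weylGroup) : ℝ :=
  LinearMap.det (RootPairing.Equiv.weightHom P w : E →ₗ[ℝ] E)

open Classical in
/-- The (indices of the) positive roots with respect to the base `b`: the roots that are
combinations of simple roots with nonnegative coefficients. -/
noncomputable def posRoots {P : RootPairing ι ℝ E N} (b : P.Base) : Finset ι :=
  {i | b.IsPos i}

/-- The half-sum of the positive roots. -/
noncomputable def halfSum {P : RootPairing ι ℝ E N} (b : P.Base) : E :=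
  (1 / 2 : ℝ) • ∑ i ∈ posRoots b, P.root i

/-- `l` is strictly dominant: it has positive scalar product with every simple root. -/
def IsStrictlyDominant {P : RootPairing ι ℝ E N} (b : P.Base) (l : E) : Prop :=
  ∀ i ∈ b.support, 0 < ⟪l, P.root i⟫

/-- The antisymmetric orbit function `φ_l(x) = ∑_{w ∈ W} (det w) e^{2πi⟨w l, x⟩}`. -/
noncomputable def antisymmOrbitFun (P : RootPairing ι ℝ E N) [P.IsRootSystem] (l x : E) : ℂ :=
  letI : Fintype P.weylGroup := Fintype.ofFinite _
  ∑ w : P.weylGroup,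
    (weylDet P w : ℂ) * Complex.exp (2 * Real.pi * Complex.I * (⟪w • l, x⟫ : ℝ))

end OrbitFunction

/-! The identity is proved formally in the group algebra of `E`, then evaluated through `e^v ↦
e^{2πi⟨v, x⟩}`. A simple reflection negates its own simple root and permutes the other positive
roots, so the denominator `∏ (e^{α/2} - e^{-α/2})` is antisymmetric under W. Its exponents are ρ
minus sums of sets of distinct positive roots, and ρ itself arises only from the empty set, with
coefficient 1. The crux is `exists_smul_halfSum_eq`: an exponent with nonzero coefficient has a
dominant conjugate, which antisymmetry keeps off the walls. Integrality then makes its difference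
from ρ dominant, while that difference is also minus a sum of positive roots, so it vanishes. The
stabiliser of ρ is trivial by the exchange condition, so antisymmetry determines every coefficient.
-/

namespace RootPairing
-- Simple reflections and the exchange condition
section
variable {ι R M N : Type*} [CommRing R] [AddCommGroup M] [Module R M] [AddCommGroup N] [Module R N]
  {P : RootPairing ι R M N}

lemma Equiv.toLinearMap_smul_coroot (w : P.Aut) (x : M) (j : ι) :
    P.toLinearMap (w • x) (P.coroot (w.indexEquiv j)) = P.toLinearMap x (P.coroot j) := by
  have h := LinearMap.congr_fun
    (Hom.weight_coweight_transpose_apply P P (P.coroot (w.indexEquiv j)) w.toHom) x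
  rw [Hom.coroot_coweightMap_apply, Equiv.symm_apply_apply] at h
  exact h

lemma Equiv.reflection_indexEquiv_apply (w : P.Aut) (j : ι) :
    Equiv.reflection P (w.indexEquiv j) = w * Equiv.reflection P j * w⁻¹ := by
  apply Equiv.weightHom_injective P
  ext x
  obtain ⟨y, rfl⟩ : ∃ y, x = w • y := ⟨w⁻¹ • x, by simp⟩
  change Equiv.reflection P (w.indexEquiv j) • w • y = (w * Equiv.reflection P j * w⁻¹) • w • y
  simp only [mul_smul, inv_smul_smul, Equiv.reflection_smul, reflection_apply, smul_sub]
  rw [smul_comm w, ← Equiv.root_indexEquiv_eq_smul]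
  congr 2
  exact Equiv.toLinearMap_smul_coroot w y j

lemma Equiv.reflection_mul_self (i : ι) : Equiv.reflection P i * Equiv.reflection P i = 1 := by
  rw [mul_eq_one_iff_inv_eq, Equiv.reflection_inv]

lemma Equiv.mul_indexEquiv_apply (v w : P.Aut) (i : ι) :
    (v * w).indexEquiv i = v.indexEquiv (w.indexEquiv i) := rfl

lemma Equiv.indexEquiv_reflectionPerm_self (w : P.Aut) (i : ι) :
    w.indexEquiv (P.reflectionPerm i i) = P.reflectionPerm (w.indexEquiv i) (w.indexEquiv i) := by
  apply P.root.injective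
  rw [Equiv.root_indexEquiv_eq_smul, root_reflectionPerm, root_reflectionPerm,
    reflection_apply_self, reflection_apply_self, smul_neg, Equiv.root_indexEquiv_eq_smul]

namespace Base
variable (b : P.Base)

variable [CharZero R] [IsDomain R] [Finite ι] [P.IsCrystallographic] [P.IsReduced]

/-- Every root is reached from simple ones by simple reflections, and the reflection in wα is the
conjugate of that in α by w. -/
lemma weylGroup_eq_closure_reflection_support :
    P.weylGroup = Subgroup.closure (Equiv.reflection P '' b.support) := by
  refine le_antisymm ?_ (Subgroup.closure_mono (Set.image_subset_range _ _))
  rw [weylGroup, Subgroup.closure_le]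
  rintro - ⟨i, rfl⟩
  refine b.induction_reflect i (p := fun i ↦ Equiv.reflection P i ∈
    Subgroup.closure (Equiv.reflection P '' b.support)) (fun i hi ↦ ?_)
    (fun i hi ↦ Subgroup.subset_closure ⟨i, hi, rfl⟩) (fun i j hi hj ↦ ?_)
  · have := Equiv.reflection_indexEquiv_apply (Equiv.reflection P i) i
    rw [Equiv.reflection_indexEquiv] at this
    rw [this]
    exact mul_mem (mul_mem hi hi) (inv_mem hi)
  · have := Equiv.reflection_indexEquiv_apply (Equiv.reflection P j) i
    rw [Equiv.reflection_indexEquiv] at this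
    have hj' : Equiv.reflection P j ∈ Subgroup.closure (Equiv.reflection P '' b.support) :=
      Subgroup.subset_closure ⟨j, hj, rfl⟩
    rw [this]
    exact mul_mem (mul_mem hj' hi) (inv_mem hj')

lemma weylGroup_induction_support {w : P.Aut} (hw : w ∈ P.weylGroup) {p : P.Aut → Prop}
    (one : p 1) (mul : ∀ i ∈ b.support, ∀ w ∈ P.weylGroup, p w → p (Equiv.reflection P i * w)) :
    p w := by
  rw [b.weylGroup_eq_closure_reflection_support] at hw mul
  induction hw using Subgroup.closure_induction_left with
  | one => exact one
  | mul_left x hx y hy ih =>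
    obtain ⟨i, hi, rfl⟩ := hx
    exact mul i hi y hy ih
  | inv_mul_cancel x hx y hy ih =>
    obtain ⟨i, hi, rfl⟩ := hx
    rw [Equiv.reflection_inv]
    exact mul i hi y hy ih

lemma exists_list_of_mem_weylGroup {w : P.Aut} (hw : w ∈ P.weylGroup) :
    ∃ l : List ι, (∀ i ∈ l, i ∈ b.support) ∧ (l.map (Equiv.reflection P)).prod = w := by
  refine b.weylGroup_induction_support hw (p := fun w ↦ ∃ l : List ι, (∀ i ∈ l, i ∈ b.support) ∧
    (l.map (Equiv.reflection P)).prod = w) ⟨[], by simp⟩ fun i hi w _ ⟨l, hl, hw⟩ ↦ ?_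
  exact ⟨i :: l, by simp_all⟩

variable {b} in
/-- The exchange condition. -/
lemma exists_list_exchange {l : List ι} (hl : ∀ i ∈ l, i ∈ b.support) {j : ι} (hj : j ∈ b.support)
    (h : ¬ b.IsPos ((l.map (Equiv.reflection P)).prod.indexEquiv j)) :
    ∃ l' : List ι, (∀ i ∈ l', i ∈ b.support) ∧ l'.length < l.length ∧
      (l.map (Equiv.reflection P)).prod =
        (l'.map (Equiv.reflection P)).prod * Equiv.reflection P j := by
  induction l with
  | nil => exact absurd (isPos_of_mem_support hj) h
  | cons i t ih =>
    simp only [List.mem_cons, forall_eq_or_imp] at hl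
    set w := (t.map (Equiv.reflection P)).prod with hw
    by_cases hk : b.IsPos (w.indexEquiv j)
    · refine ⟨t, hl.2, by simp, ?_⟩
      -- The simple reflection s_i makes no positive root other than α_i negative. Hence w α_j =
      -- α_i, so s_i w = w s_j.
      have hki : w.indexEquiv j = i := by
        by_contra hne
        refine h ?_
        rw [List.map_cons, List.prod_cons, Equiv.mul_indexEquiv_apply, Equiv.reflection_indexEquiv]
        exact hk.reflectionPerm hl.1 hne
      rw [List.map_cons, List.prod_cons, ← hw, ← hki, Equiv.reflection_indexEquiv_apply]
      group
    · obtain ⟨l', h1, h2, h3⟩ := ih hl.2 hk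
      refine ⟨i :: l', ?_, by simpa using h2, ?_⟩
      · simpa using ⟨hl.1, h1⟩
      · rw [List.map_cons, List.prod_cons, ← hw, h3, List.map_cons, List.prod_cons, mul_assoc]

/-- An element of the Weyl group which preserves positivity is trivial. -/
lemma eq_one_of_forall_isPos {w : P.Aut} (hw : w ∈ P.weylGroup)
    (h : ∀ i, b.IsPos i → b.IsPos (w.indexEquiv i)) : w = 1 := by
  obtain ⟨l, hl, rfl⟩ := b.exists_list_of_mem_weylGroup hw
  clear hw
  induction hn : l.length using Nat.strong_induction_on generalizing l with
  | _ n ih =>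
    rcases l.eq_nil_or_concat with rfl | ⟨t, j, rfl⟩
    · simp
    · have hj : j ∈ b.support := hl j (by simp)
      have ht : ∀ i ∈ t, i ∈ b.support := fun i hi ↦ hl i (by simp [hi])
      have hprod : ((t.concat j).map (Equiv.reflection P)).prod =
        (t.map (Equiv.reflection P)).prod * Equiv.reflection P j := by simp
      -- The whole word t s_j keeps α_j positive, so t makes it negative; exchange then rewrites t
      -- s_j as a shorter word.
      have hneg : ¬ b.IsPos ((t.map (Equiv.reflection P)).prod.indexEquiv j) := by
        intro hpos
        have := h j (isPos_of_mem_support hj)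
        rw [hprod, Equiv.mul_indexEquiv_apply, Equiv.reflection_indexEquiv] at this
        rw [isPos_iff, Equiv.indexEquiv_reflectionPerm_self] at this
        rw [isPos_iff] at hpos
        have := b.height_reflectionPerm_self ((t.map (Equiv.reflection P)).prod.indexEquiv j)
        simp only [indexNeg_neg] at this
        omega
      obtain ⟨l', h1, h2, h3⟩ := exists_list_exchange ht hj hneg
      rw [h3, mul_assoc, Equiv.reflection_mul_self, mul_one] at hprod
      rw [hprod] at h ⊢
      refine ih l'.length ?_ l' h1 h rfl
      simp at hn
      omega

end Base
end
end RootPairing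

/-! ### Euclidean realisation, dominance and the half-sum ρ -/

namespace OrbitFunction
open RootPairing
variable {ι E N : Type*} [NormedAddCommGroup E] [InnerProductSpace ℝ E]
  [AddCommGroup N] [Module ℝ N] {P : RootPairing ι ℝ E N}

lemma IsEuclidean.toLinearMap_coroot (hP : IsEuclidean P) (x : E) (i : ι) :
    P.toLinearMap x (P.coroot i) = 2 * ⟪x, P.root i⟫ / ⟪P.root i, P.root i⟫ := by
  have h := hP i x
  rw [reflection_apply, sub_right_inj] at h
  exact smul_left_injective ℝ (P.ne_zero i) h

lemma inner_root_self_pos (P : RootPairing ι ℝ E N) (i : ι) : 0 < ⟪P.root i, P.root i⟫ :=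
  real_inner_self_pos.mpr (P.ne_zero i)

lemma IsEuclidean.inner_root (hP : IsEuclidean P) (x : E) (i : ι) :
    ⟪x, P.root i⟫ = ⟪P.root i, P.root i⟫ / 2 * P.toLinearMap x (P.coroot i) := by
  rw [hP.toLinearMap_coroot]
  have := inner_root_self_pos P i
  field_simp

lemma IsEuclidean.inner_root_pos_iff (hP : IsEuclidean P) (x : E) (i : ι) :
    0 < ⟪x, P.root i⟫ ↔ 0 < P.toLinearMap x (P.coroot i) := by
  rw [hP.inner_root]
  exact mul_pos_iff_of_pos_left (half_pos (inner_root_self_pos P i))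

lemma IsEuclidean.inner_root_nonneg_iff (hP : IsEuclidean P) (x : E) (i : ι) :
    0 ≤ ⟪x, P.root i⟫ ↔ 0 ≤ P.toLinearMap x (P.coroot i) := by
  rw [hP.inner_root]
  exact mul_nonneg_iff_of_pos_left (half_pos (inner_root_self_pos P i))

lemma IsEuclidean.inner_reflection (hP : IsEuclidean P) (i : ι) (x y : E) :
    ⟪P.reflection i x, P.reflection i y⟫ = ⟪x, y⟫ := by
  have := inner_root_self_pos P i
  rw [hP, hP]
  simp only [inner_sub_left, inner_sub_right, real_inner_smul_left, real_inner_smul_right,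
    real_inner_comm (P.root i) x, real_inner_comm y (P.root i)]
  field_simp
  ring

lemma IsEuclidean.inner_smul_smul (hP : IsEuclidean P) {w : P.Aut} (hw : w ∈ P.weylGroup)
    (x y : E) : ⟪w • x, w • y⟫ = ⟪x, y⟫ := by
  induction hw using weylGroup.induction generalizing x y with
  | mem i => exact hP.inner_reflection i x y
  | one => simp
  | mul v w _ _ hv hw => rw [mul_smul, mul_smul, hv, hw]

variable [Fintype ι]

lemma mem_posRoots (b : P.Base) (i : ι) : i ∈ posRoots b ↔ b.IsPos i := by
  simp [posRoots]

lemma det_reflection [P.IsRootSystem] (i : ι) :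
    LinearMap.det (P.reflection i : E →ₗ[ℝ] E) = -1 := by
  have : Module.Finite ℝ E := ⟨⟨Finset.univ.map P.root, by
    simp [IsRootSystem.span_root_eq_top (P := P)]⟩⟩
  -- The determinant is then 1 plus the coroot's value on minus its root: 1 - 2.
  have h : (P.reflection i : E →ₗ[ℝ] E) = LinearMap.transvection (P.coroot' i) (-P.root i) := by
    ext x
    simp [reflection_apply, LinearMap.transvection, sub_eq_add_neg]
  rw [h, LinearMap.transvection.det]
  simp
  norm_num

section Base
variable [P.IsCrystallographic] (b : P.Base)

variable {b} in
lemma inner_nonneg_of_isPos {x : E} (hx : ∀ i ∈ b.support, 0 ≤ ⟪x, P.root i⟫) {i : ι}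
    (hi : b.IsPos i) : 0 ≤ ⟪x, P.root i⟫ :=
  hi.induction_on_add (p := fun i ↦ 0 ≤ ⟪x, P.root i⟫) hx fun i j k hk h1 hj ↦ by
    rw [hk, inner_add_right]
    exact add_nonneg h1 (hx j hj)

variable {b} in
lemma IsStrictlyDominant.inner_pos_of_isPos {x : E} (hx : IsStrictlyDominant b x) {i : ι}
    (hi : b.IsPos i) : 0 < ⟪x, P.root i⟫ :=
  hi.induction_on_add (p := fun i ↦ 0 < ⟪x, P.root i⟫) hx fun i j k hk h1 hj ↦ by
    rw [hk, inner_add_right]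
    exact add_pos h1 (hx j hj)

variable {b} in
lemma IsStrictlyDominant.inner_pos_iff {x : E} (hx : IsStrictlyDominant b x) {i : ι} :
    0 < ⟪x, P.root i⟫ ↔ b.IsPos i := by
  refine ⟨fun h ↦ ?_, hx.inner_pos_of_isPos⟩
  by_contra hi
  let := P.indexNeg
  have := hx.inner_pos_of_isPos ((Base.IsPos.neg_iff_not b i).mpr hi)
  rw [indexNeg_neg, root_reflectionPerm, reflection_apply_self, inner_neg_right] at this
  linarith

variable [P.IsReduced]

variable {b} in
lemma prod_posRoots_erase_reflectionPerm [DecidableEq ι] {A : Type*} [CommMonoid A] {j : ι}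
    (hj : j ∈ b.support) (f : ι → A) :
    ∏ i ∈ (posRoots b).erase j, f (P.reflectionPerm j i) = ∏ i ∈ (posRoots b).erase j, f i := by
  have hmaps : ∀ i ∈ (posRoots b).erase j, P.reflectionPerm j i ∈ (posRoots b).erase j := by
    intro i hi
    rw [Finset.mem_erase, mem_posRoots] at hi ⊢
    refine ⟨fun h ↦ ?_, hi.2.reflectionPerm hj hi.1⟩
    have hij : i = P.reflectionPerm j j := by rw [← P.reflectionPerm_self j i, h]
    let := P.indexNeg
    have hneg : b.IsPos (-j) := by rw [indexNeg_neg, ← hij]; exact hi.2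
    exact (Base.IsPos.neg_iff_not b j).mp hneg (Base.isPos_of_mem_support hj)
  exact Finset.prod_nbij' (P.reflectionPerm j) (P.reflectionPerm j) hmaps hmaps
    (by simp) (by simp) (by simp)

variable {b} in
lemma reflection_halfSum {j : ι} (hj : j ∈ b.support) :
    P.reflection j (halfSum b) = halfSum b - P.root j := by
  classical
  have hj' : j ∈ posRoots b := (mem_posRoots b j).mpr (Base.isPos_of_mem_support hj)
  -- `Multiplicative` turns the product lemma into one about sums of roots.
  have h := prod_posRoots_erase_reflectionPerm hj (fun i ↦ Multiplicative.ofAdd (P.root i))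
  rw [← ofAdd_sum, ← ofAdd_sum, Multiplicative.ofAdd.apply_eq_iff_eq] at h
  simp only [root_reflectionPerm, ← map_sum] at h
  rw [halfSum, ← Finset.add_sum_erase _ _ hj', map_smul, map_add, h, reflection_apply_self]
  module

variable {b} in
lemma toLinearMap_halfSum_coroot {j : ι} (hj : j ∈ b.support) :
    P.toLinearMap (halfSum b) (P.coroot j) = 1 := by
  have h := reflection_halfSum hj
  rw [reflection_apply, sub_right_inj] at h
  exact smul_left_injective ℝ (P.ne_zero j) (by simpa using h)

lemma isStrictlyDominant_halfSum (hP : IsEuclidean P) : IsStrictlyDominant b (halfSum b) := by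
  intro i hi
  rw [hP.inner_root_pos_iff, toLinearMap_halfSum_coroot hi]
  exact one_pos

variable {b} in
-- The sign of ⟨ρ, α⟩ detects positivity of α, so an isometry in W fixing ρ preserves positivity.
lemma eq_one_of_smul_halfSum_eq (hP : IsEuclidean P) {w : P.Aut} (hw : w ∈ P.weylGroup)
    (h : w • halfSum b = halfSum b) : w = 1 := by
  have hρ := isStrictlyDominant_halfSum b hP
  refine b.eq_one_of_forall_isPos hw fun i hi ↦ ?_
  rw [← hρ.inner_pos_iff] at hi ⊢
  rwa [Equiv.root_indexEquiv_eq_smul, ← h, hP.inner_smul_smul hw]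

end Base

/-! ### The Weyl denominator in the group algebra -/

section Denominator
open AddMonoidAlgebra

/-- The Weyl denominator `∏_{α > 0} (e^{α/2} - e^{-α/2})`, in the group algebra of `E`. -/
noncomputable def weylDenominator (b : P.Base) : AddMonoidAlgebra ℂ E :=
  ∏ i ∈ posRoots b, (single ((1 / 2 : ℝ) • P.root i) 1 - single (-((1 / 2 : ℝ) • P.root i)) 1)

lemma prod_single_one {κ V : Type*} [AddCommMonoid V] (s : Finset κ) (f : κ → V) :
    ∏ i ∈ s, single (f i) (1 : ℂ) = single (∑ i ∈ s, f i) 1 := by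
  classical
  induction s using Finset.induction_on with
  | empty => simp [one_def]
  | insert a s ha ih => rw [Finset.prod_insert ha, Finset.sum_insert ha, ih, single_mul_single,
      one_mul]

lemma weylDenominator_eq_sum (b : P.Base) :
    weylDenominator b = ∑ t ∈ (posRoots b).powerset,
      single (halfSum b - ∑ i ∈ t, P.root i) ((-1 : ℂ) ^ t.card) := by
  classical
  rw [weylDenominator, Finset.prod_sub]
  refine Finset.sum_congr rfl fun t ht ↦ ?_
  rw [prod_single_one, prod_single_one, mul_assoc, single_mul_single, one_mul]
  have : ((-1 : AddMonoidAlgebra ℂ E) ^ t.card) = single 0 ((-1 : ℂ) ^ t.card) := by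
    have h1 : (-1 : AddMonoidAlgebra ℂ E) = single 0 (-1) := by
      rw [one_def]
      ext
      simp
    rw [h1, single_pow, smul_zero]
  rw [this, single_mul_single, zero_add, mul_one, halfSum,
    ← Finset.sum_sdiff (Finset.mem_powerset.mp ht), Finset.sum_neg_distrib, ← Finset.smul_sum,
    ← Finset.smul_sum]
  congr 1
  module

lemma exists_subset_of_coeff_weylDenominator_ne_zero {b : P.Base} {μ : E}
    (h : (weylDenominator b).coeff μ ≠ 0) :
    ∃ t ⊆ posRoots b, μ = halfSum b - ∑ i ∈ t, P.root i := by
  classical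
  rw [weylDenominator_eq_sum, coeff_sum, Finsupp.finsetSum_apply] at h
  obtain ⟨t, ht, h⟩ := Finset.exists_ne_zero_of_sum_ne_zero h
  rw [coeff_single, Finsupp.single_apply] at h
  exact ⟨t, Finset.mem_powerset.mp ht, by by_contra hne; exact h (if_neg (Ne.symm hne))⟩

variable [P.IsCrystallographic] [P.IsReduced] (b : P.Base)

lemma coeff_weylDenominator_halfSum (hP : IsEuclidean P) :
    (weylDenominator b).coeff (halfSum b) = 1 := by
  classical
  rw [weylDenominator_eq_sum, coeff_sum, Finsupp.finsetSum_apply, Finset.sum_eq_single ∅]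
  · simp
  · intro t ht hne
    rw [coeff_single, Finsupp.single_apply, if_neg]
    intro h
    rw [sub_eq_self] at h
    have hpos : 0 < ∑ i ∈ t, ⟪halfSum b, P.root i⟫ :=
      Finset.sum_pos (fun i hi ↦ (isStrictlyDominant_halfSum b hP).inner_pos_of_isPos
        ((mem_posRoots b i).mp (Finset.mem_powerset.mp ht hi))) (Finset.nonempty_iff_ne_empty.mpr hne)
    rw [← inner_sum, h, inner_zero_right] at hpos
    exact hpos.false
  · simp

variable {b} in
lemma coeff_weylDenominator_reflection {j : ι} (hj : j ∈ b.support) (μ : E) :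
    (weylDenominator b).coeff (P.reflection j μ) = -(weylDenominator b).coeff μ := by
  classical
  have hj' : j ∈ posRoots b := (mem_posRoots b j).mpr (Base.isPos_of_mem_support hj)
  have h : domCongr ℂ ℂ (P.reflection j).toAddEquiv (weylDenominator b) = -weylDenominator b := by
    have h := prod_posRoots_erase_reflectionPerm hj (fun i ↦
      single ((1 / 2 : ℝ) • P.root i) (1 : ℂ) - single (-((1 / 2 : ℝ) • P.root i)) 1)
    rw [weylDenominator, map_prod]
    simp only [map_sub, domCongr_single, LinearEquiv.coe_toAddEquiv, map_smul,
      map_neg, ← root_reflectionPerm, LinearEquiv.coe_addEquiv_apply]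
    rw [← Finset.mul_prod_erase _ _ hj', h, ← Finset.mul_prod_erase _ _ hj', ← neg_mul]
    simp [root_reflectionPerm]
  have h2 := congr(($h).coeff (P.reflection j μ))
  rw [coeff_domCongr] at h2
  simp at h2
  rw [h2, neg_neg]

variable {b} in
lemma coeff_weylDenominator_smul [P.IsRootSystem] {w : P.Aut} (hw : w ∈ P.weylGroup) (μ : E) :
    (weylDenominator b).coeff (w • μ) =
      ((LinearMap.det (RootPairing.Equiv.weightHom P w : E →ₗ[ℝ] E) : ℝ) : ℂ) *
        (weylDenominator b).coeff μ := by
  refine b.weylGroup_induction_support hw (p := fun w ↦ (weylDenominator b).coeff (w • μ) =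
    ((LinearMap.det (RootPairing.Equiv.weightHom P w : E →ₗ[ℝ] E) : ℝ) : ℂ) *
      (weylDenominator b).coeff μ) ?_ fun i hi w _ h ↦ ?_
  · simp
  · rw [mul_smul, Equiv.reflection_smul, coeff_weylDenominator_reflection hi, h, map_mul]
    have : ((RootPairing.Equiv.weightHom P (Equiv.reflection P i) *
      RootPairing.Equiv.weightHom P w : E ≃ₗ[ℝ] E) : E →ₗ[ℝ] E) =
        (P.reflection i : E →ₗ[ℝ] E) * (RootPairing.Equiv.weightHom P w : E →ₗ[ℝ] E) := rfl
    rw [this, map_mul, det_reflection]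
    simp

variable {b} in
lemma exists_smul_halfSum_eq [P.IsRootSystem] (hP : IsEuclidean P) {μ : E}
    (h : (weylDenominator b).coeff μ ≠ 0) :
    ∃ w : P.weylGroup, w • halfSum b = μ := by
  obtain ⟨w, hmax⟩ := Finite.exists_max (fun w : P.weylGroup ↦ ⟪w • μ, halfSum b⟫)
  suffices hw : w • μ = halfSum b from ⟨w⁻¹, by rw [← hw, inv_smul_smul]⟩
  have hρ := isStrictlyDominant_halfSum b hP
  have hc : (weylDenominator b).coeff (w • μ) ≠ 0 := by
    intro h0
    have := coeff_weylDenominator_smul (b := b) (w⁻¹).2 (w • μ)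
    rw [h0, mul_zero] at this
    exact h (by simpa [Subgroup.smul_def] using this)
  obtain ⟨t, ht, hwt⟩ := exists_subset_of_coeff_weylDenominator_ne_zero hc
  -- Otherwise s_i w would increase the maximal product with ρ.
  have hge : ∀ i ∈ b.support, 0 ≤ P.toLinearMap (w • μ) (P.coroot i) := by
    intro i hi
    have h1 := hmax (weylGroup.ofIdx P i * w)
    simp only [mul_smul, weylGroup.ofIdx_smul, Equiv.reflection_smul, reflection_apply,
      inner_sub_left, real_inner_smul_left] at h1
    rw [sub_le_self_iff, real_inner_comm] at h1
    exact nonneg_of_mul_nonneg_left h1 (hρ i hi)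
  -- On a wall, s_i fixes wμ, so its coefficient equals its own negative.
  have hne : ∀ i ∈ b.support, P.toLinearMap (w • μ) (P.coroot i) ≠ 0 := by
    intro i hi h0
    have h1 := coeff_weylDenominator_reflection hi (w • μ)
    rw [reflection_apply, coroot'] at h1
    simp [h0] at h1
    exact hc (self_eq_neg.mp h1)
  have hdom : ∀ i ∈ b.support, 0 ≤ ⟪w • μ - halfSum b, P.root i⟫ := by
    intro i hi
    obtain ⟨m, hm⟩ : ∃ m : ℤ, P.toLinearMap (w • μ) (P.coroot i) = m := by
      -- The 1 is the pairing of ρ with a simple coroot. A positive integer pairing is thus at least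
      -- that of ρ.
      refine ⟨1 - ∑ k ∈ t, P.pairingIn ℤ k i, ?_⟩
      rw [hwt, map_sub, LinearMap.sub_apply, toLinearMap_halfSum_coroot hi, map_sum,
        LinearMap.sum_apply]
      push_cast
      congr 1
      refine Finset.sum_congr rfl fun k _ ↦ ?_
      rw [root_coroot_eq_pairing]
      exact (P.algebraMap_pairingIn ℤ k i).symm
    rw [hP.inner_root_nonneg_iff, map_sub, LinearMap.sub_apply, toLinearMap_halfSum_coroot hi, hm,
      sub_nonneg]
    have h1 := hge i hi
    have h2 := hne i hi
    rw [hm] at h1 h2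
    norm_cast at h1 h2 ⊢
    omega
  rw [← sub_eq_zero, ← inner_self_eq_zero (𝕜 := ℝ)]
  refine le_antisymm ?_ real_inner_self_nonneg
  calc ⟪w • μ - halfSum b, w • μ - halfSum b⟫
      = ⟪w • μ - halfSum b, -∑ i ∈ t, P.root i⟫ := by congr 1; rw [hwt]; abel
    _ = -∑ i ∈ t, ⟪w • μ - halfSum b, P.root i⟫ := by rw [inner_neg_right, inner_sum]
    _ ≤ 0 := neg_nonpos.mpr <| Finset.sum_nonneg fun i hi ↦
      inner_nonneg_of_isPos hdom ((mem_posRoots b i).mp (ht hi))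

/-- Coefficients agree: on the free orbit of ρ by antisymmetry, and off it because both sides
vanish. -/
theorem weylDenominator_eq_sum_weylGroup [P.IsRootSystem] [Fintype P.weylGroup]
    (hP : IsEuclidean P) :
    weylDenominator b = ∑ w : P.weylGroup, single (w • halfSum b) (weylDet P w : ℂ) := by
  classical
  ext μ
  rw [coeff_sum, Finsupp.finsetSum_apply]
  simp only [coeff_single, Finsupp.single_apply]
  by_cases hμ : ∃ w : P.weylGroup, w • halfSum b = μ
  · obtain ⟨w, rfl⟩ := hμ
    rw [Finset.sum_eq_single w]
    · have := coeff_weylDenominator_smul (b := b) w.2 (halfSum b)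
      rw [coeff_weylDenominator_halfSum b hP, mul_one] at this
      rw [if_pos rfl]
      exact this
    · intro v _ hv
      refine if_neg fun h ↦ hv ?_
      have h1 : (w⁻¹ * v) • halfSum b = halfSum b := by rw [mul_smul, h, inv_smul_smul]
      have h2 := eq_one_of_smul_halfSum_eq hP (w⁻¹ * v).2 h1
      exact (inv_mul_eq_one.mp (Subtype.ext h2)).symm
    · simp
  · rw [Finset.sum_eq_zero]
    · by_contra h
      exact hμ (exists_smul_halfSum_eq hP h)
    · intro w _
      exact if_neg fun h ↦ hμ ⟨w, h⟩

/-- Evaluation of an exponential sum: the algebra map with `e^v ↦ e^{2πi⟨v, x⟩}`. -/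
noncomputable def evalExp (x : E) : AddMonoidAlgebra ℂ E →ₐ[ℂ] ℂ :=
  AddMonoidAlgebra.lift ℂ ℂ E
    { toFun := fun v ↦ Complex.exp (2 * Real.pi * Complex.I * (⟪v.toAdd, x⟫ : ℝ))
      map_one' := by simp
      map_mul' := fun u v ↦ by
        rw [toAdd_mul, inner_add_left, ← Complex.exp_add]
        push_cast
        ring_nf }

lemma evalExp_single (x v : E) (c : ℂ) :
    evalExp x (single v c) = c * Complex.exp (2 * Real.pi * Complex.I * (⟪v, x⟫ : ℝ)) := by
  rw [evalExp, lift_single]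
  rfl

theorem antisymmOrbitFun_halfSum [P.IsRootSystem] (hP : IsEuclidean P) (x : E) :
    antisymmOrbitFun P (halfSum b) x =
      ∏ i ∈ posRoots b, (Complex.exp (Real.pi * Complex.I * (⟪P.root i, x⟫ : ℝ)) -
        Complex.exp (-(Real.pi * Complex.I * (⟪P.root i, x⟫ : ℝ)))) := by
  let : Fintype P.weylGroup := Fintype.ofFinite _
  have h := congr(evalExp x $(weylDenominator_eq_sum_weylGroup b hP))
  simp only [map_sum, evalExp_single] at h
  rw [antisymmOrbitFun, ← h, weylDenominator, map_prod]
  refine Finset.prod_congr rfl fun i _ ↦ ?_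
  rw [map_sub, evalExp_single, evalExp_single, inner_neg_left, real_inner_smul_left]
  push_cast
  ring_nf

end Denominator
end OrbitFunction

theorem proposition8 {ι E N : Type*} [Fintype ι] [NormedAddCommGroup E] [InnerProductSpace ℝ E]
    [AddCommGroup N] [Module ℝ N]
    (P : RootPairing ι ℝ E N) [P.IsRootSystem] [P.IsCrystallographic] [P.IsReduced]
    (hP : OrbitFunction.IsEuclidean P) (b : P.Base) :
    OrbitFunction.IsStrictlyDominant b (OrbitFunction.halfSum b) ∧
    ∀ x : E,
      OrbitFunction.antisymmOrbitFun P (OrbitFunction.halfSum b) x =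
          ∏ i ∈ OrbitFunction.posRoots b,
            (Complex.exp (Real.pi * Complex.I * (⟪P.root i, x⟫ : ℝ)) -
              Complex.exp (-(Real.pi * Complex.I * (⟪P.root i, x⟫ : ℝ)))) ∧
      OrbitFunction.antisymmOrbitFun P (OrbitFunction.halfSum b) x =
          Complex.exp (2 * Real.pi * Complex.I * (⟪OrbitFunction.halfSum b, x⟫ : ℝ)) *
            ∏ i ∈ OrbitFunction.posRoots b,
              (1 - Complex.exp (-(2 * Real.pi * Complex.I * (⟪P.root i, x⟫ : ℝ)))) ∧
      OrbitFunction.antisymmOrbitFun P (OrbitFunction.halfSum b) x =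
          (2 * Complex.I) ^ (OrbitFunction.posRoots b).card *
            ∏ i ∈ OrbitFunction.posRoots b, (Real.sin (Real.pi * ⟪P.root i, x⟫) : ℂ) := by
  refine ⟨OrbitFunction.isStrictlyDominant_halfSum b hP, fun x ↦ ?_⟩
  rw [OrbitFunction.antisymmOrbitFun_halfSum b hP x]
  refine ⟨rfl, ?_, ?_⟩
  · have h : Complex.exp (2 * Real.pi * Complex.I * (⟪OrbitFunction.halfSum b, x⟫ : ℝ)) =
        ∏ i ∈ OrbitFunction.posRoots b,
          Complex.exp (Real.pi * Complex.I * (⟪P.root i, x⟫ : ℝ)) := by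
      rw [← Complex.exp_sum, OrbitFunction.halfSum, real_inner_smul_left, sum_inner,
        ← Finset.mul_sum]
      push_cast
      ring_nf
    rw [h, ← Finset.prod_mul_distrib]
    refine Finset.prod_congr rfl fun i _ ↦ ?_
    rw [mul_sub, mul_one, ← Complex.exp_add]
    ring_nf
  · rw [← Finset.prod_const, ← Finset.prod_mul_distrib]
    refine Finset.prod_congr rfl fun i _ ↦ ?_
    rw [Complex.ofReal_sin, Complex.sin]
    push_cast
    have hI := Complex.I_sq
    have h1 : -((Real.pi : ℂ) * (⟪P.root i, x⟫ : ℝ)) * Complex.I =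
      -(Real.pi * Complex.I * (⟪P.root i, x⟫ : ℝ)) := by ring
    have h2 : ((Real.pi : ℂ) * (⟪P.root i, x⟫ : ℝ)) * Complex.I =
      Real.pi * Complex.I * (⟪P.root i, x⟫ : ℝ) := by ring
    rw [h1, h2]
    -- With sin z = (e^{-iz} - e^{iz}) i/2, the two sides differ by (e^{iz} - e^{-iz})(i² + 1).
    linear_combination (Complex.exp (Real.pi * Complex.I * (⟪P.root i, x⟫ : ℝ)) -
      Complex.exp (-(Real.pi * Complex.I * (⟪P.root i, x⟫ : ℝ)))) * hI
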